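/- Let $a$ be a random vector in $\mathbb{R}^d$ with $\mathbb{E}\|a\|^2<\infty$, let $n\ge 1$, and let $a_1,\dots,a_n$ be i.i.d. random vectors with the same law as $a$. Let $\varphi_1,\varphi_2:\mathbb{R}\to\mathbb{R}$ be Lipschitz continuous with constants $L_1$ and $L_2$ respectively, and let $\mathcal X,\mathcal Y\subset\mathbb{R}^d$ be sets contained in the closed Euclidean balls centred at $0$ of radii $D_1$ and $D_2$ respectively. Assume that, for every $i$, for all $x\in\mathcal X$ and $y\in\mathcal Y$, $|\varphi_1(a_i^\top x)|\le B_1$ and $|\varphi_2(a_i^\top y)|\le B_2$ almost surely. Set $$Z=\sup_{x\in\mathcal X,\;y\in\mathcal Y}\Big\{\frac1n\sum_{i=1}^n\varphi_1(a_i^\top x)\,\varphi_2(a_i^\top y)-\mathbb{E}\big[\varphi_1(a^\top x)\,\varphi_2(a^\top y)\big]\Big\}.$$ Then, for every $0<\delta\le 1$, with probability at least $1-\delta$, $$Z\;\le\;\sqrt{4\pi}\,\frac{(\mathbb{E}\|a\|^2)^{1/2}}{\sqrt n}\,\big(B_2L_1D_1+B_1L_2D_2\big)+\frac{2B_1B_2}{\sqrt{2n}}\sqrt{\log\frac1\delta}.$$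 -/

import Mathlib

open MeasureTheory ProbabilityTheory

/-- The deviation of the empirical mean of `φ₁(aᵢᵀx) φ₂(aᵢᵀy)` over the sample `a₁, …, aₙ`
from its expectation `𝔼 φ₁(aᵀx) φ₂(aᵀy)`, at the outcome `ω`. -/
noncomputable def empiricalDeviation {Ω : Type*} [MeasurableSpace Ω] (μ : Measure Ω) {d n : ℕ}
    (a : Ω → EuclideanSpace ℝ (Fin d)) (as : Fin n → Ω → EuclideanSpace ℝ (Fin d))
    (φ₁ φ₂ : ℝ → ℝ) (x y : EuclideanSpace ℝ (Fin d)) (ω : Ω) : ℝ :=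
  (1 / (n : ℝ)) * ∑ i, φ₁ (inner ℝ (as i ω) x) * φ₂ (inner ℝ (as i ω) y)
    - ∫ ω', φ₁ (inner ℝ (a ω') x) * φ₂ (inner ℝ (a ω') y) ∂μ

/-- The supremum of the deviation over `x ∈ X`, `y ∈ Y`, taken in the extended reals, so that it is
the true supremum whatever the sets are (and `-∞` if one of them is empty). -/
noncomputable def supDeviation {Ω : Type*} [MeasurableSpace Ω] (μ : Measure Ω) {d n : ℕ}
    (a : Ω → EuclideanSpace ℝ (Fin d)) (as : Fin n → Ω → EuclideanSpace ℝ (Fin d))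
    (φ₁ φ₂ : ℝ → ℝ) (X Y : Set (EuclideanSpace ℝ (Fin d))) (ω : Ω) : EReal :=
  ⨆ x ∈ X, ⨆ y ∈ Y, (empiricalDeviation μ a as φ₁ φ₂ x y ω : EReal)

/-! The supremum is concentrated around its mean by McDiarmid's inequality, and the mean is bounded
by symmetrization and contraction.

For the mean, no auxiliary random signs are introduced: the sample is removed one variable at a
time. For one variable `z`, symmetrization replaces the centred `h t z` by `± 2 * h t z`, and
`ciSup_add_ciSup_le_of_abs_sub_le` replaces these by four equally weighted linear terms, `± 4k⟨z, x
t⟩` and `± 4l⟨z, y t⟩`. Linear terms merely move the parameters `s`, `r` of `shiftedSup`, so a bound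
stated for all `s`, `r` is stable under induction. Each step adds `8k²𝔼‖z‖²` or `8l²𝔼‖z‖²` under a
square root (`average_sqrt_le` and Jensen). At `s = r = 0` this gives the constant `√8 ≤ √(4π)`.

These arguments use finitely many parameters and everywhere bounded activations. Clipping the
activations gives the latter; continuity in `(x, y)` and a dense sequence pass from finite families
to `X × Y`. -/

/-! ### McDiarmid's inequality on a product space -/

theorem measurePreserving_fin_cons {α : Type*} [MeasurableSpace α] (ν : Measure α)
    [IsProbabilityMeasure ν] (n : ℕ) :
    MeasurePreserving (fun p : α × (Fin n → α) => (Fin.cons p.1 p.2 : Fin (n + 1) → α))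
      (ν.prod (Measure.pi fun _ : Fin n => ν)) (Measure.pi fun _ : Fin (n + 1) => ν) := by
  have h := (measurePreserving_piFinSuccAbove (fun _ : Fin (n + 1) => ν) 0).symm
  convert h using 2 with p
  simp [MeasurableEquiv.piFinSuccAbove_symm_apply, Fin.insertNthEquiv, Fin.insertNth_zero']

theorem integral_pi_fin_succ {α : Type*} [MeasurableSpace α] (ν : Measure α)
    [IsProbabilityMeasure ν] (n : ℕ) (f : (Fin (n + 1) → α) → ℝ) :
    ∫ w, f w ∂(Measure.pi fun _ : Fin (n + 1) => ν)
      = ∫ p, f (Fin.cons p.1 p.2) ∂(ν.prod (Measure.pi fun _ : Fin n => ν)) := by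
  have h := (measurePreserving_piFinSuccAbove (fun _ : Fin (n + 1) => ν) 0).symm
  rw [← h.integral_comp' f]
  simp [MeasurableEquiv.piFinSuccAbove_symm_apply, Fin.insertNthEquiv, Fin.insertNth_zero']

theorem abs_integral_le_of_abs_le {α : Type*} [MeasurableSpace α] {ν : Measure α}
    [IsProbabilityMeasure ν] {f : α → ℝ} {C : ℝ} (h : ∀ x, |f x| ≤ C) : |∫ x, f x ∂ν| ≤ C := by
  simpa using norm_integral_le_of_norm_le_const (μ := ν) (f := f) (ae_of_all _ h)

theorem Measurable.integrable_of_abs_le {α : Type*} [MeasurableSpace α] {ν : Measure α}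
    [IsFiniteMeasure ν] {f : α → ℝ} {C : ℝ} (hf : Measurable f) (h : ∀ x, |f x| ≤ C) :
    Integrable f ν :=
  Integrable.of_bound hf.aestronglyMeasurable C (ae_of_all _ h)

theorem integrable_exp_mul_of_abs_le {α : Type*} [MeasurableSpace α] {ν : Measure α}
    [IsFiniteMeasure ν] {f : α → ℝ} {C : ℝ} (hf : Measurable f) (h : ∀ x, |f x| ≤ C) (t : ℝ) :
    Integrable (fun x => Real.exp (t * f x)) ν :=
  integrable_exp_mul_of_mem_Icc hf.aemeasurable (ae_of_all _ fun x => abs_le.1 (h x))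

/-- **McDiarmid's inequality**, exponential moment form. -/
theorem integral_exp_le_of_bounded_differences {α : Type*} [MeasurableSpace α] (ν : Measure α)
    [IsProbabilityMeasure ν] {c C : ℝ} (hc : 0 ≤ c) (t : ℝ) : ∀ (n : ℕ) (f : (Fin n → α) → ℝ),
    Measurable f → (∀ w, |f w| ≤ C) → (∀ w i z, |f (Function.update w i z) - f w| ≤ c) →
    ∫ w, Real.exp (t * (f w - ∫ v, f v ∂(Measure.pi fun _ : Fin n => ν)))
      ∂(Measure.pi fun _ : Fin n => ν) ≤ Real.exp (n * (c / 2) ^ 2 * t ^ 2 / 2) := by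
  intro n
  induction n with
  | zero =>
    intro f _ _ _
    have : ∀ w : Fin 0 → α, f w = f default := fun w => by rw [Subsingleton.elim w default]
    simp [this]
  | succ n ih =>
    intro f hf hC hd
    set P := Measure.pi fun _ : Fin n => ν
    set F : α × (Fin n → α) → ℝ := fun p => f (Fin.cons p.1 p.2) with hFdef
    have hFm : Measurable F := hf.comp (measurePreserving_fin_cons ν n).measurable
    have hFC : ∀ p, |F p| ≤ C := fun p => hC _
    set g : α → ℝ := fun z => ∫ w, F (z, w) ∂P with hg
    have hgm : Measurable g := (hFm.stronglyMeasurable.integral_prod_right').measurable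
    have hgC : ∀ z, |g z| ≤ C := fun z => abs_integral_le_of_abs_le fun w => hFC _
    have hFi : ∀ z, Integrable (fun w => F (z, w)) P := fun z =>
      (hFm.comp measurable_prodMk_left).integrable_of_abs_le fun w => hFC _
    have hgd : ∀ z z', g z ≤ g z' + c := by
      intro z z'
      have h1 : g z - g z' = ∫ w, (F (z, w) - F (z', w)) ∂P := (integral_sub (hFi z) (hFi z')).symm
      have h2 : |g z - g z'| ≤ c := by
        rw [h1]
        refine abs_integral_le_of_abs_le fun w => ?_
        have := hd (Fin.cons z' w) 0 z
        rwa [Fin.update_cons_zero] at this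
      linarith [le_abs_self (g z - g z')]
    have hM : ∫ v, f v ∂(Measure.pi fun _ : Fin (n + 1) => ν) = ∫ z, g z ∂ν := by
      rw [integral_pi_fin_succ]
      exact integral_prod F (hFm.integrable_of_abs_le hFC)
    rw [hM, integral_pi_fin_succ]
    set M := ∫ z, g z ∂ν
    have hMC : |M| ≤ C := abs_integral_le_of_abs_le hgC
    have hne : Nonempty α := nonempty_of_isProbabilityMeasure ν
    have hbdd : BddBelow (Set.range g) := ⟨-C, by rintro _ ⟨z, rfl⟩; exact (abs_le.1 (hgC z)).1⟩
    -- Hoeffding's lemma: `g` oscillates by at most `c`, so it lies in an interval of length `c`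
    -- starting at its infimum.
    have hsub := hasSubgaussianMGF_of_mem_Icc (μ := ν) (a := ⨅ z, g z) (b := (⨅ z, g z) + c)
      hgm.aemeasurable (ae_of_all _ fun z => ⟨ciInf_le hbdd z, by
        have : g z - c ≤ ⨅ z, g z := le_ciInf fun z' => by linarith [hgd z z']
        linarith⟩)
    have hmgf : ∫ z, Real.exp (t * (g z - M)) ∂ν ≤ Real.exp ((c / 2) ^ 2 * t ^ 2 / 2) := by
      have := hsub.mgf_le t
      simpa [mgf, abs_of_nonneg hc] using this
    have hint : Integrable (fun p : α × (Fin n → α) => Real.exp (t * (F p - M))) (ν.prod P) :=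
      integrable_exp_mul_of_abs_le (C := C + C) (hFm.sub_const M)
        (fun p => (abs_sub _ _).trans (add_le_add (hFC p) hMC)) t
    have hgi : Integrable (fun z => Real.exp (t * (g z - M))) ν :=
      integrable_exp_mul_of_abs_le (C := C + C) (hgm.sub_const M)
        (fun p => (abs_sub _ _).trans (add_le_add (hgC p) hMC)) t
    calc ∫ p, Real.exp (t * (F p - M)) ∂(ν.prod P)
        = ∫ z, ∫ w, Real.exp (t * (F (z, w) - M)) ∂P ∂ν := integral_prod _ hint
      _ ≤ ∫ z, Real.exp (t * (g z - M)) * Real.exp (n * (c / 2) ^ 2 * t ^ 2 / 2) ∂ν := by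
        refine integral_mono hint.integral_prod_left (hgi.mul_const _) fun z => ?_
        -- Martingale splitting `F - M = (g - M) + (F - g)`; with `z` frozen, the second term falls
        -- under the induction hypothesis with the same `c`.
        have h1 : ∀ w, Real.exp (t * (F (z, w) - M))
            = Real.exp (t * (g z - M)) * Real.exp (t * (F (z, w) - g z)) := fun w => by
          rw [← Real.exp_add]; ring_nf
        simp only [h1]
        rw [integral_const_mul]
        refine mul_le_mul_of_nonneg_left ?_ (Real.exp_nonneg _)
        refine ih (fun w => F (z, w)) (hFm.comp measurable_prodMk_left) (fun w => hFC _) ?_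
        intro w i y
        have := hd (Fin.cons z w) i.succ y
        rwa [← Fin.cons_update] at this
      _ ≤ Real.exp ((c / 2) ^ 2 * t ^ 2 / 2) * Real.exp (n * (c / 2) ^ 2 * t ^ 2 / 2) := by
        rw [integral_mul_const]
        exact mul_le_mul_of_nonneg_right hmgf (Real.exp_nonneg _)
      _ = _ := by rw [← Real.exp_add]; push_cast; ring_nf

/-- **McDiarmid's inequality**: a bounded measurable function of `n` i.i.d. variables whose value
changes by at most `c` when one of them is changed is sub-Gaussian. -/
theorem hasSubgaussianMGF_of_bounded_differences {α : Type*} [MeasurableSpace α] (ν : Measure α)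
    [IsProbabilityMeasure ν] {n : ℕ} (c : NNReal) {C : ℝ} {f : (Fin n → α) → ℝ} (hf : Measurable f)
    (hC : ∀ w, |f w| ≤ C) (hd : ∀ w i z, |f (Function.update w i z) - f w| ≤ c) :
    HasSubgaussianMGF (fun w => f w - ∫ v, f v ∂(Measure.pi fun _ : Fin n => ν))
      (n * (c / 2) ^ 2) (Measure.pi fun _ : Fin n => ν) where
  integrable_exp_mul t := integrable_exp_mul_of_abs_le (C := C + C) (hf.sub_const _)
    (fun p => (abs_sub _ _).trans (add_le_add (hC p) (abs_integral_le_of_abs_le hC))) t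
  mgf_le t := by
    simpa [mgf] using integral_exp_le_of_bounded_differences ν c.coe_nonneg t n f hf hC hd

/-! ### Symmetrization, contraction and Jensen bounds for one variable -/

theorem le_ciSup_of_finite {T : Type*} [Finite T] (c : T → ℝ) (t : T) : c t ≤ ⨆ t, c t :=
  le_ciSup (Set.finite_range c).bddAbove t

theorem abs_ciSup_le_of_finite {T : Type*} [Finite T] [Nonempty T] {c : T → ℝ} {C : ℝ}
    (h : ∀ t, |c t| ≤ C) : |⨆ t, c t| ≤ C := by
  obtain ⟨t⟩ := ‹Nonempty T›
  exact abs_le.2 ⟨(abs_le.1 (h t)).1.trans (le_ciSup_of_finite c t),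
    ciSup_le fun t => (abs_le.1 (h t)).2⟩

/-- Contraction for a two-point Rademacher average: if `h` is dominated by `p` and `q`, its
symmetrized supremum is at most the average of those of `2p` and `2q`. -/
theorem ciSup_add_ciSup_le_of_abs_sub_le {T : Type*} [Finite T] [Nonempty T] (c h p q : T → ℝ)
    (hh : ∀ t t', |h t - h t'| ≤ |p t - p t'| + |q t - q t'|) :
    ((⨆ t, (c t + 2 * h t)) + ⨆ t, (c t - 2 * h t)) / 2
      ≤ ((⨆ t, (c t + 4 * p t)) + (⨆ t, (c t - 4 * p t))
        + ((⨆ t, (c t + 4 * q t)) + ⨆ t, (c t - 4 * q t))) / 4 := by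
  -- The sign of `r t - r t'` decides which of `t`, `t'` is tested in which supremum; `c t + c t'`
  -- is symmetric, so the absolute value comes for free.
  have key : ∀ (r : T → ℝ) t t', c t + c t' + 4 * |r t - r t'|
      ≤ (⨆ t, (c t + 4 * r t)) + ⨆ t, (c t - 4 * r t) := by
    intro r t t'
    have h1 := le_ciSup_of_finite (fun t => c t + 4 * r t)
    have h2 := le_ciSup_of_finite (fun t => c t - 4 * r t)
    rcases abs_cases (r t - r t') with ⟨h, -⟩ | ⟨h, -⟩ <;> rw [h] <;>
      linarith [h1 t, h1 t', h2 t, h2 t']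
  set K := ((⨆ t, (c t + 4 * p t)) + (⨆ t, (c t - 4 * p t))
        + ((⨆ t, (c t + 4 * q t)) + ⨆ t, (c t - 4 * q t))) / 4 with hK
  have h1 : ∀ t t', (c t + 2 * h t) + (c t' - 2 * h t') ≤ 2 * K := fun t t' => by
    linarith [key p t t', key q t t', hh t t', le_abs_self (h t - h t')]
  have h2 : (⨆ t, (c t + 2 * h t)) ≤ 2 * K - ⨆ t, (c t - 2 * h t) := ciSup_le fun t => by
    have : (⨆ t, (c t - 2 * h t)) ≤ 2 * K - (c t + 2 * h t) := ciSup_le fun t' => by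
      linarith [h1 t t']
    linarith
  linarith

/-- Symmetrization of one variable. -/
theorem integral_ciSup_add_sub_integral_le {α T : Type*} [MeasurableSpace α] [Finite T]
    [Nonempty T] (ν : Measure α) [IsProbabilityMeasure ν] (c : T → ℝ) {h : T → α → ℝ} {C : ℝ}
    (hm : ∀ t, Measurable (h t)) (hC : ∀ t z, |h t z| ≤ C) :
    ∫ z, (⨆ t, (c t + (h t z - ∫ v, h t v ∂ν))) ∂ν
      ≤ ∫ z, ((⨆ t, (c t + 2 * h t z)) + ⨆ t, (c t - 2 * h t z)) / 2 ∂ν := by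
  obtain ⟨A, hA⟩ : ∃ A, ∀ t, |c t| ≤ A := by
    obtain ⟨A, hA⟩ := (Set.finite_range fun t => |c t|).bddAbove
    exact ⟨A, fun t => hA ⟨t, rfl⟩⟩
  have hi : ∀ k : ℝ, Integrable (fun z => ⨆ t, (c t + k * h t z)) ν := fun k =>
    Measurable.integrable_of_abs_le (C := A + |k| * C)
      (Measurable.iSup fun t => ((hm t).const_mul k).const_add (c t))
      fun z => abs_ciSup_le_of_finite fun t => (abs_add_le _ _).trans <| by
        rw [abs_mul]
        exact add_le_add (hA t) (mul_le_mul_of_nonneg_left (hC t z) (abs_nonneg k))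
  have hm' : ∀ t, |∫ v, h t v ∂ν| ≤ C := fun t => abs_integral_le_of_abs_le (hC t)
  have hi' : Integrable (fun z => ⨆ t, (c t + (h t z - ∫ v, h t v ∂ν))) ν :=
    Measurable.integrable_of_abs_le (C := A + (C + C))
      (Measurable.iSup fun t => ((hm t).sub_const _).const_add (c t))
      fun z => abs_ciSup_le_of_finite fun t => (abs_add_le _ _).trans <|
        add_le_add (hA t) ((abs_sub _ _).trans (add_le_add (hC t z) (hm' t)))
  have hi2 := hi (-2)
  simp only [neg_mul, ← sub_eq_add_neg] at hi2
  -- Supremum of means is at most mean of suprema; this plays the role of the independent copy.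
  have hconst : (⨆ t, (c t - 2 * ∫ v, h t v ∂ν)) ≤ ∫ z, (⨆ t, (c t - 2 * h t z)) ∂ν := by
    refine ciSup_le fun t => ?_
    have hti : Integrable (h t) ν := (hm t).integrable_of_abs_le (hC t)
    calc c t - 2 * ∫ v, h t v ∂ν = ∫ z, (c t - 2 * h t z) ∂ν := by
          rw [integral_sub (integrable_const _) (hti.const_mul 2), integral_const_mul]; simp
      _ ≤ _ := integral_mono ((integrable_const _).sub (hti.const_mul 2)) hi2
          fun z => le_ciSup_of_finite (fun t => c t - 2 * h t z) t
  calc ∫ z, (⨆ t, (c t + (h t z - ∫ v, h t v ∂ν))) ∂ν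
      ≤ ∫ z, ((⨆ t, (c t + 2 * h t z)) + ⨆ t, (c t - 2 * ∫ v, h t v ∂ν)) / 2 ∂ν := by
        refine integral_mono hi' (((hi 2).add (integrable_const _)).div_const 2) fun z => ?_
        -- The argument of the supremum is the midpoint of `c t + 2 * h t z` and `c t - 2 * ∫ v, h t
        -- v ∂ν`.
        refine ciSup_le fun t => ?_
        have h1 := le_ciSup_of_finite (fun t => c t + 2 * h t z) t
        have h2 := le_ciSup_of_finite (fun t => c t - 2 * ∫ v, h t v ∂ν) t
        simp only at h1 h2 ⊢
        linarith
    _ ≤ _ := by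
        rw [integral_div, integral_div, integral_add (hi 2) (integrable_const _),
          integral_add (hi 2) hi2]
        simp only [integral_const, probReal_univ, one_smul]
        linarith

theorem integral_sqrt_le_sqrt_integral {α : Type*} [MeasurableSpace α] (ν : Measure α)
    [IsProbabilityMeasure ν] {g : α → ℝ} (hg : Integrable g ν) (h0 : ∀ z, 0 ≤ g z) :
    Integrable (fun z => √(g z)) ν ∧ ∫ z, √(g z) ∂ν ≤ √(∫ z, g z ∂ν) := by
  have hi : Integrable (fun z => √(g z)) ν := by
    refine Integrable.mono' (hg.add (integrable_const 1))
      (Real.continuous_sqrt.comp_aestronglyMeasurable hg.aestronglyMeasurable)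
      (ae_of_all _ fun z => ?_)
    rw [Real.norm_eq_abs, abs_of_nonneg (Real.sqrt_nonneg _), Pi.add_apply]
    nlinarith [Real.sq_sqrt (h0 z), sq_nonneg (√(g z) - 1), h0 z]
  exact ⟨hi, Real.strictConcaveOn_sqrt.concaveOn.le_map_integral Real.continuous_sqrt.continuousOn
    isClosed_Ici (ae_of_all _ h0) hg hi⟩

/-- Concavity of the square root and the parallelogram law. The shift `± u` occurs with total weight
one half, the other half leaving `s` fixed, hence `‖u‖ ^ 2 / 2`. -/
theorem average_sqrt_le {E : Type*} [NormedAddCommGroup E] [InnerProductSpace ℝ E] (s u : E)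
    {V : ℝ} (hV : 0 ≤ V) :
    (√(‖s + u‖ ^ 2 + V) + √(‖s - u‖ ^ 2 + V) + 2 * √(‖s‖ ^ 2 + V)) / 4
      ≤ √(‖s‖ ^ 2 + V + ‖u‖ ^ 2 / 2) := by
  have hp := parallelogram_law_with_norm ℝ s u
  refine Real.le_sqrt_of_sq_le ?_
  have h1 := Real.sq_sqrt (add_nonneg (sq_nonneg ‖s + u‖) hV)
  have h2 := Real.sq_sqrt (add_nonneg (sq_nonneg ‖s - u‖) hV)
  have h3 := Real.sq_sqrt (add_nonneg (sq_nonneg ‖s‖) hV)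
  set A := √(‖s + u‖ ^ 2 + V)
  set B := √(‖s - u‖ ^ 2 + V)
  set D := √(‖s‖ ^ 2 + V)
  nlinarith [sq_nonneg (A - B), sq_nonneg (A - D), sq_nonneg (B - D)]

/-! ### Mean of the supremum over the whole sample -/

section

variable {E T : Type*} [NormedAddCommGroup E] [InnerProductSpace ℝ E]

/-- The supremum of a sum of centred functions, shifted by the linear process with parameters
`s` and `r`. -/
noncomputable def shiftedSup [MeasurableSpace E] (ν : Measure E) (x y : T → E) (h : T → E → ℝ)
    (n : ℕ) (s r : E) (w : Fin n → E) : ℝ :=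
  ⨆ t, (inner ℝ s (x t) + inner ℝ r (y t) + ∑ i, (h t (w i) - ∫ v, h t v ∂ν))

variable [MeasurableSpace E] [BorelSpace E] [SecondCountableTopology E] [Finite T] [Nonempty T]
  (ν : Measure E) [IsProbabilityMeasure ν] {x y : T → E} {h : T → E → ℝ} {C D₁ D₂ : ℝ}

omit [Nonempty T] [IsProbabilityMeasure ν] in
theorem measurable_shiftedSup (hm : ∀ t, Measurable (h t)) (n : ℕ) :
    Measurable fun p : (E × E) × (Fin n → E) => shiftedSup ν x y h n p.1.1 p.1.2 p.2 := by
  refine Measurable.iSup fun t => ?_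
  have h1 : Measurable fun s : E => (inner ℝ s (x t) : ℝ) := by fun_prop
  have h2 : Measurable fun s : E => (inner ℝ s (y t) : ℝ) := by fun_prop
  have h3 : ∀ i : Fin n, Measurable fun p : (E × E) × (Fin n → E) => h t (p.2 i) := fun i =>
    (hm t).comp ((measurable_pi_apply i).comp measurable_snd)
  exact ((h1.comp (measurable_fst.comp measurable_fst)).add
    (h2.comp (measurable_snd.comp measurable_fst))).add
    (Finset.measurable_fun_sum _ fun i _ => (h3 i).sub_const _)

omit [BorelSpace E] [SecondCountableTopology E] in
theorem abs_shiftedSup_le (hC : ∀ t z, |h t z| ≤ C) (hx : ∀ t, ‖x t‖ ≤ D₁) (hy : ∀ t, ‖y t‖ ≤ D₂)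
    (n : ℕ) (s r : E) (w : Fin n → E) :
    |shiftedSup ν x y h n s r w| ≤ ‖s‖ * D₁ + ‖r‖ * D₂ + n * (C + C) := by
  refine abs_ciSup_le_of_finite fun t => ?_
  have h1 : |(inner ℝ s (x t) : ℝ)| ≤ ‖s‖ * D₁ := (abs_real_inner_le_norm _ _).trans
    (mul_le_mul_of_nonneg_left (hx t) (norm_nonneg _))
  have h2 : |(inner ℝ r (y t) : ℝ)| ≤ ‖r‖ * D₂ := (abs_real_inner_le_norm _ _).trans
    (mul_le_mul_of_nonneg_left (hy t) (norm_nonneg _))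
  have h3 : |∑ i, (h t (w i) - ∫ v, h t v ∂ν)| ≤ n * (C + C) := by
    refine (Finset.abs_sum_le_sum_abs _ _).trans ?_
    refine (Finset.sum_le_card_nsmul _ _ (C + C) fun i _ => ?_).trans (by simp [mul_add])
    exact (abs_sub _ _).trans (add_le_add (hC t _) (abs_integral_le_of_abs_le (hC t)))
  exact (abs_add_le _ _).trans (add_le_add ((abs_add_le _ _).trans (add_le_add h1 h2)) h3)

/-- Once a sample point enters the shift, the supremum is no longer bounded, but it grows at most
linearly in the norm of that point. -/
theorem integrable_shiftedSup_comp (hm : ∀ t, Measurable (h t)) (hC : ∀ t z, |h t z| ≤ C)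
    (hx : ∀ t, ‖x t‖ ≤ D₁) (hy : ∀ t, ‖y t‖ ≤ D₂) (hν : Integrable (fun z => ‖z‖) ν)
    (n : ℕ) (s r : E) (k l : ℝ) :
    Integrable (fun p : E × (Fin n → E) => shiftedSup ν x y h n (s + k • p.1) (r + l • p.1) p.2)
      (ν.prod (Measure.pi fun _ : Fin n => ν)) := by
  have hD₁ : 0 ≤ D₁ := by obtain ⟨t⟩ := ‹Nonempty T›; exact (norm_nonneg _).trans (hx t)
  have hD₂ : 0 ≤ D₂ := by obtain ⟨t⟩ := ‹Nonempty T›; exact (norm_nonneg _).trans (hy t)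
  have hfst : Integrable (fun p : E × (Fin n → E) => ‖p.1‖)
      (ν.prod (Measure.pi fun _ : Fin n => ν)) := hν.comp_fst _
  have hdom : Integrable (fun p : E × (Fin n → E) => (‖s‖ + |k| * ‖p.1‖) * D₁
      + (‖r‖ + |l| * ‖p.1‖) * D₂ + n * (C + C)) (ν.prod (Measure.pi fun _ : Fin n => ν)) :=
    ((((integrable_const _).add (hfst.const_mul _)).mul_const _).add
      (((integrable_const _).add (hfst.const_mul _)).mul_const _)).add (integrable_const _)
  refine hdom.mono' ?_ (ae_of_all _ fun p => ?_)
  · refine Measurable.aestronglyMeasurable ?_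
    exact (measurable_shiftedSup ν hm n).comp (f := fun p : E × (Fin n → E) =>
      ((s + k • p.1, r + l • p.1), p.2)) (by fun_prop)
  · refine (abs_shiftedSup_le ν hC hx hy n _ _ _).trans ?_
    have h1 : ‖s + k • p.1‖ ≤ ‖s‖ + |k| * ‖p.1‖ := (norm_add_le _ _).trans (by simp [norm_smul])
    have h2 : ‖r + l • p.1‖ ≤ ‖r‖ + |l| * ‖p.1‖ := (norm_add_le _ _).trans (by simp [norm_smul])
    gcongr

/-- Symmetrization and contraction over a whole sample, one variable at a time. -/
theorem integral_shiftedSup_le (hm : ∀ t, Measurable (h t)) (hC : ∀ t z, |h t z| ≤ C)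
    (hx : ∀ t, ‖x t‖ ≤ D₁) (hy : ∀ t, ‖y t‖ ≤ D₂) (hν : Integrable (fun z => ‖z‖) ν)
    (hν2 : Integrable (fun z => ‖z‖ ^ 2) ν) (k l : ℝ)
    (hh : ∀ t t' z, |h t z - h t' z| ≤ |k * inner ℝ z (x t) - k * inner ℝ z (x t')|
      + |l * inner ℝ z (y t) - l * inner ℝ z (y t')|) (n : ℕ) : ∀ s r : E,
    ∫ w, shiftedSup ν x y h n s r w ∂(Measure.pi fun _ : Fin n => ν)
      ≤ D₁ * √(‖s‖ ^ 2 + n * (8 * k ^ 2 * ∫ z, ‖z‖ ^ 2 ∂ν))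
        + D₂ * √(‖r‖ ^ 2 + n * (8 * l ^ 2 * ∫ z, ‖z‖ ^ 2 ∂ν)) := by
  have hD₁ : 0 ≤ D₁ := by obtain ⟨t⟩ := ‹Nonempty T›; exact (norm_nonneg _).trans (hx t)
  have hD₂ : 0 ≤ D₂ := by obtain ⟨t⟩ := ‹Nonempty T›; exact (norm_nonneg _).trans (hy t)
  have hσ : 0 ≤ ∫ z, ‖z‖ ^ 2 ∂ν := integral_nonneg fun z => sq_nonneg _
  set σ := ∫ z, ‖z‖ ^ 2 ∂ν with hσdef
  induction n with
  | zero =>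
    intro s r
    have h1 : ∀ w, shiftedSup ν x y h 0 s r w ≤ D₁ * ‖s‖ + D₂ * ‖r‖ := fun w => by
      have := (le_abs_self _).trans (abs_shiftedSup_le ν hC hx hy 0 s r w)
      simp only [Nat.cast_zero, zero_mul, add_zero] at this
      linarith
    have h2 : ∀ w, shiftedSup ν x y h 0 s r w = shiftedSup ν x y h 0 s r default := fun w => by
      rw [Subsingleton.elim w default]
    simp only [h2, Nat.cast_zero, zero_mul, add_zero, Real.sqrt_sq (norm_nonneg _),
      integral_const, probReal_univ, one_smul]
    exact h1 _
  | succ n ih =>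
    intro s r
    set P := Measure.pi fun _ : Fin n => ν
    set G : E → E → (Fin n → E) → ℝ := shiftedSup ν x y h n with hG
    have hGi : ∀ a b : ℝ, Integrable (fun p : E × (Fin n → E) =>
        G (s + a • p.1) (r + b • p.1) p.2) (ν.prod P) :=
      fun a b => integrable_shiftedSup_comp ν hm hC hx hy hν n s r a b
    have hcons : ∀ p : E × (Fin n → E), shiftedSup ν x y h (n + 1) s r (Fin.cons p.1 p.2)
        = ⨆ t, ((inner ℝ s (x t) + inner ℝ r (y t) + ∑ i, (h t (p.2 i) - ∫ v, h t v ∂ν))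
          + (h t p.1 - ∫ v, h t v ∂ν)) := fun p => by
      simp only [shiftedSup, Fin.sum_univ_succ, Fin.cons_zero, Fin.cons_succ]
      congr 1; ext t; ring
    have hi0 : Integrable (fun p : E × (Fin n → E) =>
        shiftedSup ν x y h (n + 1) s r (Fin.cons p.1 p.2)) (ν.prod P) := by
      refine Measurable.integrable_of_abs_le
        ((measurable_shiftedSup ν hm (n + 1)).comp (f := fun p : E × (Fin n → E) =>
          ((s, r), (Fin.cons p.1 p.2 : Fin (n + 1) → E)))
          (measurable_const.prodMk (measurePreserving_fin_cons ν n).measurable))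
        fun p => abs_shiftedSup_le ν hC hx hy _ _ _ _
    -- The four linear terms produced by contraction, absorbed into the shifts. The zero multiples
    -- keep all four in the form covered by `hGi`.
    set Q : E × (Fin n → E) → ℝ := fun p =>
      (G (s + (4 * k) • p.1) (r + (0 : ℝ) • p.1) p.2
        + G (s + (-(4 * k)) • p.1) (r + (0 : ℝ) • p.1) p.2
        + (G (s + (0 : ℝ) • p.1) (r + (4 * l) • p.1) p.2
          + G (s + (0 : ℝ) • p.1) (r + (-(4 * l)) • p.1) p.2)) / 4 with hQ
    have hQi : Integrable Q (ν.prod P) :=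
      (((hGi _ _).add (hGi _ _)).add ((hGi _ _).add (hGi _ _))).div_const 4
    have hpt : ∀ (w : Fin n → E) z, ((⨆ t, ((inner ℝ s (x t) + inner ℝ r (y t)
          + ∑ i, (h t (w i) - ∫ v, h t v ∂ν)) + 2 * h t z))
        + ⨆ t, ((inner ℝ s (x t) + inner ℝ r (y t)
          + ∑ i, (h t (w i) - ∫ v, h t v ∂ν)) - 2 * h t z)) / 2 ≤ Q (z, w) := by
      intro w z
      refine (ciSup_add_ciSup_le_of_abs_sub_le _ _ (fun t => k * inner ℝ z (x t))
        (fun t => l * inner ℝ z (y t)) fun t t' => hh t t' z).trans (le_of_eq ?_)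
      simp only [hQ, hG, shiftedSup, inner_add_left, real_inner_smul_left, zero_mul, add_zero]
      congr 1
      congr 1 <;> congr 1 <;> congr 1 <;> ext t <;> ring
    have hsymi : ∀ w : Fin n → E, Integrable (fun z => ((⨆ t, ((inner ℝ s (x t) + inner ℝ r (y t)
          + ∑ i, (h t (w i) - ∫ v, h t v ∂ν)) + 2 * h t z))
        + ⨆ t, ((inner ℝ s (x t) + inner ℝ r (y t)
          + ∑ i, (h t (w i) - ∫ v, h t v ∂ν)) - 2 * h t z)) / 2) ν := by
      intro w
      obtain ⟨A, hA⟩ := (Set.finite_range fun t => |inner ℝ s (x t) + inner ℝ r (y t)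
          + ∑ i, (h t (w i) - ∫ v, h t v ∂ν)|).bddAbove
      have hb : ∀ t z, |2 * h t z| ≤ 2 * C := fun t z => by
        rw [abs_mul, abs_two]; linarith [hC t z]
      refine (Integrable.add ?_ ?_).div_const 2
      · exact Measurable.integrable_of_abs_le
          (Measurable.iSup fun t => ((hm t).const_mul 2).const_add _)
          fun z => abs_ciSup_le_of_finite fun t => (abs_add_le _ _).trans
            (add_le_add (hA ⟨t, rfl⟩) (hb t z))
      · exact Measurable.integrable_of_abs_le
          (Measurable.iSup fun t => ((hm t).const_mul 2).const_sub _)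
          fun z => abs_ciSup_le_of_finite fun t => (abs_sub _ _).trans
            (add_le_add (hA ⟨t, rfl⟩) (hb t z))
    have hQae : ∀ᵐ w ∂P, Integrable (fun z => Q (z, w)) ν := hQi.prod_left_ae
    have hV : ∀ m : ℝ, 0 ≤ (n : ℝ) * (8 * m ^ 2 * σ) := fun m => by positivity
    -- The increment `‖(4 * m) • z‖ ^ 2 / 2 = 8 * m ^ 2 * ‖z‖ ^ 2` is the source of the constant 8.
    have hsq : ∀ (v : E) (m : ℝ),
        Integrable (fun z => ‖v‖ ^ 2 + n * (8 * m ^ 2 * σ) + ‖(4 * m) • z‖ ^ 2 / 2) ν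
        ∧ ∫ z, (‖v‖ ^ 2 + n * (8 * m ^ 2 * σ) + ‖(4 * m) • z‖ ^ 2 / 2) ∂ν
          = ‖v‖ ^ 2 + (n + 1 : ℕ) * (8 * m ^ 2 * σ) := by
      intro v m
      have h1 : ∀ z : E, ‖(4 * m) • z‖ ^ 2 / 2 = (8 * m ^ 2) * ‖z‖ ^ 2 := fun z => by
        rw [norm_smul, mul_pow, Real.norm_eq_abs, sq_abs]; ring
      simp only [h1]
      refine ⟨(integrable_const _).add (hν2.const_mul _), ?_⟩
      rw [integral_add (integrable_const _) (hν2.const_mul _), integral_const_mul]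
      simp only [integral_const, probReal_univ, one_smul]
      push_cast; ring
    have hroot := fun (v : E) (m : ℝ) => integral_sqrt_le_sqrt_integral ν (hsq v m).1
      fun z => by have := hV m; positivity
    calc ∫ w, shiftedSup ν x y h (n + 1) s r w ∂(Measure.pi fun _ : Fin (n + 1) => ν)
        = ∫ w, ∫ z, shiftedSup ν x y h (n + 1) s r (Fin.cons z w) ∂ν ∂P := by
          rw [integral_pi_fin_succ]; exact integral_prod_symm _ hi0
      _ ≤ ∫ w, ∫ z, Q (z, w) ∂ν ∂P := by
          refine integral_mono_ae hi0.integral_prod_right hQi.integral_prod_right ?_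
          filter_upwards [hQae] with w hw
          simp only [fun z => hcons (z, w)]
          refine (integral_ciSup_add_sub_integral_le ν _ hm hC).trans ?_
          exact integral_mono (hsymi w) hw (hpt w)
      -- Symmetrization averages over `z` with `w` fixed, the induction hypothesis over `w` with `z`
      -- fixed.
      _ = ∫ z, ∫ w, Q (z, w) ∂P ∂ν := (integral_integral_swap hQi).symm
      _ ≤ ∫ z, (D₁ * √(‖s‖ ^ 2 + n * (8 * k ^ 2 * σ) + ‖(4 * k) • z‖ ^ 2 / 2)
            + D₂ * √(‖r‖ ^ 2 + n * (8 * l ^ 2 * σ) + ‖(4 * l) • z‖ ^ 2 / 2)) ∂ν := by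
          refine integral_mono_ae hQi.integral_prod_left
            (((hroot s k).1.const_mul _).add ((hroot r l).1.const_mul _)) ?_
          filter_upwards [(hGi (4 * k) 0).prod_right_ae, (hGi (-(4 * k)) 0).prod_right_ae,
            (hGi 0 (4 * l)).prod_right_ae, (hGi 0 (-(4 * l))).prod_right_ae] with z h1 h2 h3 h4
          simp only [hQ]
          have h12 : Integrable (fun w => G (s + (4 * k) • z) (r + (0 : ℝ) • z) w
            + G (s + (-(4 * k)) • z) (r + (0 : ℝ) • z) w) P := h1.add h2
          have h34 : Integrable (fun w => G (s + (0 : ℝ) • z) (r + (4 * l) • z) w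
            + G (s + (0 : ℝ) • z) (r + (-(4 * l)) • z) w) P := h3.add h4
          rw [integral_div, integral_add h12 h34, integral_add h1 h2, integral_add h3 h4]
          have e1 := ih (s + (4 * k) • z) (r + (0 : ℝ) • z)
          have e2 := ih (s + (-(4 * k)) • z) (r + (0 : ℝ) • z)
          have e3 := ih (s + (0 : ℝ) • z) (r + (4 * l) • z)
          have e4 := ih (s + (0 : ℝ) • z) (r + (-(4 * l)) • z)
          have a1 := mul_le_mul_of_nonneg_left (average_sqrt_le s ((4 * k) • z) (hV k)) hD₁
          have a2 := mul_le_mul_of_nonneg_left (average_sqrt_le r ((4 * l) • z) (hV l)) hD₂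
          simp only [zero_smul, add_zero, neg_smul, ← sub_eq_add_neg] at e1 e2 e3 e4 ⊢
          linarith
      _ ≤ _ := by
          rw [integral_add ((hroot s k).1.const_mul _) ((hroot r l).1.const_mul _),
            integral_const_mul, integral_const_mul, ← (hsq s k).2, ← (hsq r l).2]
          exact add_le_add (mul_le_mul_of_nonneg_left (hroot s k).2 hD₁)
            (mul_le_mul_of_nonneg_left (hroot r l).2 hD₂)

end

/-! ### Deviation bound for finite families and bounded activations -/

section

variable {E T : Type*} [NormedAddCommGroup E] [InnerProductSpace ℝ E] [MeasurableSpace E]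
  [Finite T] [Nonempty T]

/-- Only one summand changes and its centring cancels. This is the bounded-difference input of
McDiarmid's inequality. -/
theorem abs_shiftedSup_update_sub_le (ν : Measure E) (x y : T → E) {h : T → E → ℝ} {B : ℝ}
    (hB : ∀ t z, |h t z| ≤ B) {n : ℕ} (s r : E) (w : Fin n → E) (i : Fin n) (z : E) :
    |shiftedSup ν x y h n s r (Function.update w i z) - shiftedSup ν x y h n s r w|
      ≤ 2 * B := by
  have key : ∀ t, |(∑ j, (h t (Function.update w i z j) - ∫ v, h t v ∂ν))
      - ∑ j, (h t (w j) - ∫ v, h t v ∂ν)| ≤ 2 * B := fun t => by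
    rw [← Finset.sum_sub_distrib, Finset.sum_eq_single i]
    · rw [Function.update_self, sub_sub_sub_cancel_right]
      exact (abs_sub _ _).trans (by linarith [hB t z, hB t (w i)])
    · intro j _ hj
      rw [Function.update_of_ne hj, sub_self]
    · simp
  rw [abs_sub_le_iff]
  constructor
  · rw [sub_le_iff_le_add]
    refine ciSup_le fun t => ?_
    have h1 := le_ciSup_of_finite (fun t => inner ℝ s (x t) + inner ℝ r (y t)
      + ∑ j, (h t (w j) - ∫ v, h t v ∂ν)) t
    have h2 := (abs_le.1 (key t)).2
    simp only [shiftedSup] at h1 ⊢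
    linarith
  · rw [sub_le_iff_le_add]
    refine ciSup_le fun t => ?_
    have h1 := le_ciSup_of_finite (fun t => inner ℝ s (x t) + inner ℝ r (y t)
      + ∑ j, (h t (Function.update w i z j) - ∫ v, h t v ∂ν)) t
    have h2 := (abs_le.1 (key t)).1
    simp only [shiftedSup] at h1 ⊢
    linarith

end

/-- The product-rule splitting supplies the contraction hypothesis with `k = B₂ * L₁` and `l = B₁ *
L₂`. -/
theorem abs_mul_sub_mul_le_of_lipschitzWith {φ₁ φ₂ : ℝ → ℝ} {L₁ L₂ : NNReal}
    (hφ₁ : LipschitzWith L₁ φ₁) (hφ₂ : LipschitzWith L₂ φ₂)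
    {B₁ B₂ : ℝ} (hB₁ : ∀ u, |φ₁ u| ≤ B₁) (hB₂ : ∀ u, |φ₂ u| ≤ B₂) (u u' v v' : ℝ) :
    |φ₁ u * φ₂ v - φ₁ u' * φ₂ v'|
      ≤ |B₂ * L₁ * u - B₂ * L₁ * u'| + |B₁ * L₂ * v - B₁ * L₂ * v'| := by
  have h1 : |φ₁ u - φ₁ u'| ≤ L₁ * |u - u'| := by simpa [Real.dist_eq] using hφ₁.dist_le_mul u u'
  have h2 : |φ₂ v - φ₂ v'| ≤ L₂ * |v - v'| := by simpa [Real.dist_eq] using hφ₂.dist_le_mul v v'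
  have b1 : 0 ≤ B₁ := (abs_nonneg _).trans (hB₁ 0)
  have b2 : 0 ≤ B₂ := (abs_nonneg _).trans (hB₂ 0)
  have e1 : |B₂ * L₁ * u - B₂ * L₁ * u'| = B₂ * (L₁ * |u - u'|) := by
    rw [← mul_sub, abs_mul, abs_of_nonneg (mul_nonneg b2 L₁.coe_nonneg), mul_assoc]
  have e2 : |B₁ * L₂ * v - B₁ * L₂ * v'| = B₁ * (L₂ * |v - v'|) := by
    rw [← mul_sub, abs_mul, abs_of_nonneg (mul_nonneg b1 L₂.coe_nonneg), mul_assoc]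
  have e : φ₁ u * φ₂ v - φ₁ u' * φ₂ v' = φ₂ v * (φ₁ u - φ₁ u') + φ₁ u' * (φ₂ v - φ₂ v') := by ring
  rw [e, e1, e2]
  refine (abs_add_le _ _).trans (add_le_add ?_ ?_)
  · rw [abs_mul]; exact mul_le_mul (hB₂ v) h1 (abs_nonneg _) b2
  · rw [abs_mul]; exact mul_le_mul (hB₁ u') h2 (abs_nonneg _) b1

theorem sqrt_mul_eight_mul_sq {n : ℕ} {k S : ℝ} (hk : 0 ≤ k) :
    √((n : ℝ) * (8 * k ^ 2 * S)) = √n * (√8 * √S * k) := by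
  rw [Real.sqrt_mul (by positivity), Real.sqrt_mul (by positivity), Real.sqrt_mul (by positivity),
    Real.sqrt_sq hk]
  ring

section

variable {E T : Type*} [NormedAddCommGroup E] [InnerProductSpace ℝ E] [MeasurableSpace E]
  [BorelSpace E] [SecondCountableTopology E] [Finite T]

/-- The deviation bound for finitely many pairs of parameters and bounded activations. -/
theorem deviation_bound_of_finite (ν : Measure E) [IsProbabilityMeasure ν]
    (hν : MemLp id 2 ν) {n : ℕ} (hn : 0 < n)
    {φ₁ φ₂ : ℝ → ℝ} {L₁ L₂ : NNReal} (hφ₁ : LipschitzWith L₁ φ₁) (hφ₂ : LipschitzWith L₂ φ₂)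
    {B₁ B₂ : ℝ} (hB₁ : ∀ u, |φ₁ u| ≤ B₁) (hB₂ : ∀ u, |φ₂ u| ≤ B₂)
    {x y : T → E} {D₁ D₂ : ℝ} (hx : ∀ t, ‖x t‖ ≤ D₁) (hy : ∀ t, ‖y t‖ ≤ D₂)
    {δ : ℝ} (hδ₀ : 0 < δ) (hδ₁ : δ ≤ 1) :
    1 - δ ≤ (Measure.pi fun _ : Fin n => ν).real {w | ∀ t,
      (1 / (n : ℝ)) * ∑ i, φ₁ (inner ℝ (w i) (x t)) * φ₂ (inner ℝ (w i) (y t))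
        - ∫ z, φ₁ (inner ℝ z (x t)) * φ₂ (inner ℝ z (y t)) ∂ν ≤
      √(4 * Real.pi) * (√(∫ z, ‖z‖ ^ 2 ∂ν) / √(n : ℝ)) * (B₂ * L₁ * D₁ + B₁ * L₂ * D₂)
        + 2 * B₁ * B₂ / √(2 * (n : ℝ)) * √(Real.log (1 / δ))} := by
  rcases isEmpty_or_nonempty T with hT | hT
  · simp [hδ₀.le]
  set P := Measure.pi fun _ : Fin n => ν
  set h : T → E → ℝ := fun t z => φ₁ (inner ℝ z (x t)) * φ₂ (inner ℝ z (y t)) with hh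
  have b1 : 0 ≤ B₁ := (abs_nonneg _).trans (hB₁ 0)
  have b2 : 0 ≤ B₂ := (abs_nonneg _).trans (hB₂ 0)
  have d1 : 0 ≤ D₁ := (norm_nonneg _).trans (hx hT.some)
  have d2 : 0 ≤ D₂ := (norm_nonneg _).trans (hy hT.some)
  have hm : ∀ t, Measurable (h t) := fun t => by
    have h1 := hφ₁.continuous
    have h2 := hφ₂.continuous
    exact Continuous.measurable (by fun_prop)
  have hC : ∀ t z, |h t z| ≤ B₁ * B₂ := fun t z => by
    rw [hh, abs_mul]; exact mul_le_mul (hB₁ _) (hB₂ _) (abs_nonneg _) b1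
  have hν2 : Integrable (fun z => ‖z‖ ^ 2) ν := hν.integrable_norm_pow (by norm_num)
  have hν1 : Integrable (fun z => ‖z‖) ν := (hν.integrable (by norm_num)).norm
  set f : (Fin n → E) → ℝ := shiftedSup ν x y h n 0 0 with hf
  have hfm : Measurable f := (measurable_shiftedSup (x := x) (y := y) ν hm n).comp
    (f := fun w => (((0 : E), (0 : E)), w)) (by fun_prop)
  have hmean := integral_shiftedSup_le ν hm hC hx hy hν1 hν2 (B₂ * L₁) (B₁ * L₂)
    (fun t t' z => abs_mul_sub_mul_le_of_lipschitzWith hφ₁ hφ₂ hB₁ hB₂ _ _ _ _) n 0 0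
  rw [norm_zero, zero_pow two_ne_zero, zero_add, zero_add,
    sqrt_mul_eight_mul_sq (mul_nonneg b2 L₁.coe_nonneg),
    sqrt_mul_eight_mul_sq (mul_nonneg b1 L₂.coe_nonneg)] at hmean
  have hB : 0 ≤ B₁ * B₂ := mul_nonneg b1 b2
  set S := √(∫ z, ‖z‖ ^ 2 ∂ν)
  have hS : 0 ≤ S := Real.sqrt_nonneg _
  set R := B₂ * L₁ * D₁ + B₁ * L₂ * D₂ with hR
  have hR0 : 0 ≤ R := by positivity
  have hlog : 0 ≤ Real.log (1 / δ) := Real.log_nonneg (by rw [le_div_iff₀ hδ₀]; linarith)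
  have hn' : (0 : ℝ) < n := by exact_mod_cast hn
  have hsn : 0 < √(n : ℝ) := Real.sqrt_pos.2 hn'
  -- Chosen so that the tail `exp (-ε² / (2n(B₁B₂)²))` equals `δ` when `B₁ * B₂ > 0`.
  set ε := B₁ * B₂ * (√(2 * n) * √(Real.log (1 / δ))) with hε
  have hε0 : 0 ≤ ε := by positivity
  have hε2 : ε ^ 2 = (B₁ * B₂) ^ 2 * (2 * n * Real.log (1 / δ)) := by
    rw [hε, mul_pow, mul_pow (√(2 * (n : ℝ))), Real.sq_sqrt (by positivity), Real.sq_sqrt hlog]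
  have hthr : √8 * √n * S * R + ε
      ≤ n * (√(4 * Real.pi) * (S / √n) * R + 2 * B₁ * B₂ / √(2 * n) * √(Real.log (1 / δ))) := by
    have e1 : (n : ℝ) * (√(4 * Real.pi) * (S / √n) * R) = √(4 * Real.pi) * √n * S * R := by
      have h1 : (n : ℝ) / √n = √n := Real.div_sqrt
      calc _ = √(4 * Real.pi) * (n / √n) * S * R := by ring
        _ = _ := by rw [h1]
    have e2 : (n : ℝ) * (2 * B₁ * B₂ / √(2 * n) * √(Real.log (1 / δ))) = ε := by
      have h1 : 2 * (n : ℝ) / √(2 * n) = √(2 * n) := Real.div_sqrt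
      calc _ = B₁ * B₂ * (2 * n / √(2 * n) * √(Real.log (1 / δ))) := by ring
        _ = _ := by rw [h1]
    rw [mul_add (n : ℝ), e1, e2]
    gcongr
    -- What remains is `8 ≤ 4π`.
    linarith [Real.pi_gt_three]
  have hmean' : ∫ w, f w ∂P ≤ √8 * √n * S * R := hmean.trans (le_of_eq (by rw [hR]; ring))
  have hsubset : {w | f w ≤ ∫ v, f v ∂P + ε} ⊆ {w | ∀ t,
      (1 / (n : ℝ)) * ∑ i, φ₁ (inner ℝ (w i) (x t)) * φ₂ (inner ℝ (w i) (y t))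
        - ∫ z, φ₁ (inner ℝ z (x t)) * φ₂ (inner ℝ z (y t)) ∂ν ≤
      √(4 * Real.pi) * (S / √(n : ℝ)) * R
        + 2 * B₁ * B₂ / √(2 * (n : ℝ)) * √(Real.log (1 / δ))} := by
    intro w hw t
    have h1 : ∑ i, (h t (w i) - ∫ v, h t v ∂ν) ≤ f w := by
      have := le_ciSup_of_finite (fun t => inner ℝ (0 : E) (x t) + inner ℝ (0 : E) (y t)
        + ∑ j, (h t (w j) - ∫ v, h t v ∂ν)) t
      simpa [hf, shiftedSup] using this
    rw [Finset.sum_sub_distrib] at h1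
    simp only [Finset.sum_const, Finset.card_univ, Fintype.card_fin, nsmul_eq_mul] at h1
    refine le_of_mul_le_mul_left ?_ hn'
    have h2 : (n : ℝ) * ((1 / (n : ℝ)) * ∑ i, h t (w i) - ∫ v, h t v ∂ν)
        = ∑ i, h t (w i) - n * ∫ v, h t v ∂ν := by field_simp
    have hw' : f w ≤ ∫ v, f v ∂P + ε := hw
    exact h2.le.trans (by linarith)
  refine le_trans ?_ (measureReal_mono hsubset)
  have hsub := hasSubgaussianMGF_of_bounded_differences ν (n := n) (2 * (B₁ * B₂).toNNReal) hfm
    (fun w => abs_shiftedSup_le ν hC hx hy n 0 0 w)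
    (fun w i z => by
      rw [NNReal.coe_mul, Real.coe_toNNReal _ hB]
      exact abs_shiftedSup_update_sub_le ν x y hC 0 0 w i z)
  have hmeas : MeasurableSet {w | f w ≤ ∫ v, f v ∂P + ε} := measurableSet_le hfm measurable_const
  have hcompl : P.real {w | f w ≤ ∫ v, f v ∂P + ε}ᶜ ≤ δ := by
    -- If `B₁ * B₂ = 0` the variance proxy vanishes and the tail bound is void, but then `f` is
    -- constant.
    rcases hB.eq_or_lt with h0 | hpos
    · have hconst : ∀ w w', f w = f w' := by
        have hz : ∀ t z, h t z = 0 := fun t z => by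
          have := hC t z; rw [← h0] at this; exact abs_nonpos_iff.1 this
        intro w w'
        simp [hf, shiftedSup, hz]
      have : {w | f w ≤ ∫ v, f v ∂P + ε}ᶜ = ∅ := by
        rw [Set.compl_empty_iff, Set.eq_univ_iff_forall]
        intro w
        have : ∫ v, f v ∂P = f w := by simp [fun v => hconst v w]
        simp [this, hε0]
      rw [this]; simp [hδ₀.le]
    · refine (measureReal_mono (fun w hw => ?_)).trans
        ((hsub.measure_ge_le hε0).trans (le_of_eq ?_))
      · simp only [Set.mem_compl_iff, Set.mem_ofPred_eq, not_le] at hw ⊢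
        linarith
      · have : -ε ^ 2 / (2 * ((n * (2 * (B₁ * B₂).toNNReal / 2) ^ 2 : NNReal) : ℝ))
            = -Real.log (1 / δ) := by
          rw [hε2]
          push_cast
          rw [Real.coe_toNNReal _ hB]
          have : B₁ ≠ 0 := by rintro rfl; simp at hpos
          have : B₂ ≠ 0 := by rintro rfl; simp at hpos
          field_simp
        rw [this, one_div, Real.log_inv, neg_neg, Real.exp_log hδ₀]
  rw [probReal_compl_eq_one_sub hmeas] at hcompl
  linarith

end

/-! ### Clipping, and transfer from the law of the sample to `Ω` -/

theorem max_neg_min_eq_self {B u : ℝ} (h : |u| ≤ B) : max (-B) (min B u) = u := by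
  rw [min_eq_right (abs_le.1 h).2, max_eq_right (abs_le.1 h).1]

theorem abs_max_neg_min_le {B : ℝ} (hB : 0 ≤ B) (u : ℝ) : |max (-B) (min B u)| ≤ B :=
  abs_le.2 ⟨le_max_left _ _, max_le (by linarith) (min_le_left _ _)⟩

section

variable {Ω E T : Type*} [MeasurableSpace Ω] {μ : Measure Ω} [IsProbabilityMeasure μ]

omit [IsProbabilityMeasure μ] in
theorem ProbabilityTheory.IdentDistrib.ae_abs_comp_inner_le [NormedAddCommGroup E] [InnerProductSpace ℝ E]
    [MeasurableSpace E] [BorelSpace E] {a b : Ω → E} (hab : IdentDistrib a b μ μ)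
    {φ : ℝ → ℝ} (hφ : Continuous φ) {x : E} {B : ℝ}
    (h : ∀ᵐ ω ∂μ, |φ (inner ℝ (a ω) x)| ≤ B) : ∀ᵐ ω ∂μ, |φ (inner ℝ (b ω) x)| ≤ B := by
  refine hab.ae_mem_snd (t := {z | |φ (inner ℝ z x)| ≤ B}) ?_ h
  exact (isClosed_le (by fun_prop) continuous_const).measurableSet

/-- The deviation bound for finitely many pairs of parameters. -/
theorem empiricalDeviation_bound_of_finite [Finite T] {d n : ℕ} (hn : 0 < n)
    {a : Ω → EuclideanSpace ℝ (Fin d)} {as : Fin n → Ω → EuclideanSpace ℝ (Fin d)}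
    (ha : MemLp a 2 μ) (hindep : iIndepFun as μ) (hident : ∀ i, IdentDistrib (as i) a μ μ)
    {φ₁ φ₂ : ℝ → ℝ} {L₁ L₂ : NNReal} (hφ₁ : LipschitzWith L₁ φ₁) (hφ₂ : LipschitzWith L₂ φ₂)
    {x y : T → EuclideanSpace ℝ (Fin d)} {D₁ D₂ : ℝ} (hx : ∀ t, ‖x t‖ ≤ D₁) (hy : ∀ t, ‖y t‖ ≤ D₂)
    {B₁ B₂ : ℝ} (hB₁ : ∀ i t, ∀ᵐ ω ∂μ, |φ₁ (inner ℝ (as i ω) (x t))| ≤ B₁)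
    (hB₂ : ∀ i t, ∀ᵐ ω ∂μ, |φ₂ (inner ℝ (as i ω) (y t))| ≤ B₂)
    {δ : ℝ} (hδ₀ : 0 < δ) (hδ₁ : δ ≤ 1) :
    1 - δ ≤ μ.real {ω | ∀ t, empiricalDeviation μ a as φ₁ φ₂ (x t) (y t) ω ≤
      √(4 * Real.pi) * (√(∫ ω', ‖a ω'‖ ^ 2 ∂μ) / √(n : ℝ)) * (B₂ * L₁ * D₁ + B₁ * L₂ * D₂)
        + 2 * B₁ * B₂ / √(2 * (n : ℝ)) * √(Real.log (1 / δ))} := by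
  rcases isEmpty_or_nonempty T with hT | ⟨⟨t₀⟩⟩
  · simp [hδ₀.le]
  have b1 : 0 ≤ B₁ := by
    obtain ⟨ω, hω⟩ := (hB₁ ⟨0, hn⟩ t₀).exists
    exact (abs_nonneg _).trans hω
  have b2 : 0 ≤ B₂ := by
    obtain ⟨ω, hω⟩ := (hB₂ ⟨0, hn⟩ t₀).exists
    exact (abs_nonneg _).trans hω
  set ψ₁ : ℝ → ℝ := fun u => max (-B₁) (min B₁ (φ₁ u)) with hψ₁
  set ψ₂ : ℝ → ℝ := fun u => max (-B₂) (min B₂ (φ₂ u)) with hψ₂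
  have lip₁ : LipschitzWith L₁ ψ₁ := (hφ₁.const_min B₁).const_max (-B₁)
  have lip₂ : LipschitzWith L₂ ψ₂ := (hφ₂.const_min B₂).const_max (-B₂)
  have cψ₁ := lip₁.continuous
  have cψ₂ := lip₂.continuous
  have ham : AEMeasurable a μ := ha.aestronglyMeasurable.aemeasurable
  have hasm : ∀ i, AEMeasurable (as i) μ := fun i => (hident i).aemeasurable_fst
  have hmap : μ.map (fun ω i => as i ω) = Measure.pi fun _ : Fin n => μ.map a := by
    rw [(iIndepFun_iff_map_fun_eq_pi_map hasm).1 hindep]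
    simp only [(hident _).map_eq]
  have : IsProbabilityMeasure (μ.map a) := Measure.isProbabilityMeasure_map ham
  have hν : MemLp id 2 (μ.map a) := (memLp_map_measure_iff aestronglyMeasurable_id ham).2 ha
  have main := deviation_bound_of_finite (T := T) (μ.map a) hν hn lip₁ lip₂
    (abs_max_neg_min_le b1 <| φ₁ ·) (abs_max_neg_min_le b2 <| φ₂ ·) hx hy hδ₀ hδ₁
  have hnorm : ∫ z, ‖z‖ ^ 2 ∂(μ.map a) = ∫ ω, ‖a ω‖ ^ 2 ∂μ :=
    integral_map ham (by fun_prop)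
  have hmean : ∀ t, ∫ z, ψ₁ (inner ℝ z (x t)) * ψ₂ (inner ℝ z (y t)) ∂(μ.map a)
      = ∫ ω, φ₁ (inner ℝ (a ω) (x t)) * φ₂ (inner ℝ (a ω) (y t)) ∂μ := fun t => by
    rw [integral_map ham (Continuous.aestronglyMeasurable (by fun_prop))]
    refine integral_congr_ae ?_
    -- The almost sure bounds are given for the sample only; they pass to `a` through its first
    -- member, which exists since `0 < n`.
    filter_upwards [(hident ⟨0, hn⟩).ae_abs_comp_inner_le hφ₁.continuous (hB₁ _ t),
      (hident ⟨0, hn⟩).ae_abs_comp_inner_le hφ₂.continuous (hB₂ _ t)] with ω h1 h2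
    simp only [hψ₁, hψ₂, max_neg_min_eq_self h1, max_neg_min_eq_self h2]
  simp only [hnorm, hmean] at main
  rw [← hmap, map_measureReal_apply_of_aemeasurable (aemeasurable_pi_lambda _ hasm)] at main
  · refine main.trans (le_of_eq (measureReal_congr ?_))
    have hae : ∀ᵐ ω ∂μ, ∀ i t, |φ₁ (inner ℝ (as i ω) (x t))| ≤ B₁
        ∧ |φ₂ (inner ℝ (as i ω) (y t))| ≤ B₂ := by
      simp only [ae_all_iff]
      exact fun i t => (hB₁ i t).and (hB₂ i t)
    filter_upwards [hae] with ω hω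
    refine propext (forall_congr' fun t => ?_)
    simp only [empiricalDeviation, hψ₁, hψ₂, max_neg_min_eq_self (hω _ _).1,
      max_neg_min_eq_self (hω _ _).2]
  · refine IsClosed.measurableSet ?_
    simp only [Set.ofPred_forall]
    exact isClosed_iInter fun t => isClosed_le (by fun_prop) continuous_const

/-- Dominated convergence with the constant `B₁ * B₂`. Continuity for every `ω` lets a dense
sequence of parameters decide the supremum. -/
theorem continuous_empiricalDeviation {d n : ℕ}
    {a : Ω → EuclideanSpace ℝ (Fin d)} (as : Fin n → Ω → EuclideanSpace ℝ (Fin d))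
    (ha : AEMeasurable a μ) {φ₁ φ₂ : ℝ → ℝ} (hφ₁ : Continuous φ₁) (hφ₂ : Continuous φ₂)
    {X Y : Set (EuclideanSpace ℝ (Fin d))} {B₁ B₂ : ℝ}
    (hB₁ : ∀ x ∈ X, ∀ᵐ ω ∂μ, |φ₁ (inner ℝ (a ω) x)| ≤ B₁)
    (hB₂ : ∀ y ∈ Y, ∀ᵐ ω ∂μ, |φ₂ (inner ℝ (a ω) y)| ≤ B₂) (ω : Ω) :
    Continuous fun p : X ×ˢ Y => empiricalDeviation μ a as φ₁ φ₂ p.1.1 p.1.2 ω := by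
  have hint : Continuous fun p : X ×ˢ Y =>
      ∫ ω', φ₁ (inner ℝ (a ω') p.1.1) * φ₂ (inner ℝ (a ω') p.1.2) ∂μ := by
    refine continuous_of_dominated (bound := fun _ => B₁ * B₂) ?_ ?_ (integrable_const _) ?_
    · intro p
      have hc : Continuous fun z => φ₁ (inner ℝ z p.1.1) * φ₂ (inner ℝ z p.1.2) := by fun_prop
      exact hc.comp_aestronglyMeasurable ha.aestronglyMeasurable
    · intro p
      filter_upwards [hB₁ _ p.2.1, hB₂ _ p.2.2] with ω' h1 h2
      rw [Real.norm_eq_abs, abs_mul]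
      exact mul_le_mul h1 h2 (abs_nonneg _) ((abs_nonneg _).trans h1)
    · exact ae_of_all _ fun ω' => by fun_prop
  unfold empiricalDeviation
  exact Continuous.sub (by fun_prop) hint

end

/-! ### From finite families to the full supremum -/

theorem mainTheorem4 {Ω : Type*} [MeasurableSpace Ω] (μ : Measure Ω) [IsProbabilityMeasure μ]
    (d n : ℕ) (hn : 0 < n)
    -- the generic vector `a`, with finite second moment, and the i.i.d. sample `a₁, …, aₙ`
    (a : Ω → EuclideanSpace ℝ (Fin d)) (as : Fin n → Ω → EuclideanSpace ℝ (Fin d))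
    (ha : MemLp a 2 μ)
    (hindep : iIndepFun as μ)
    (hident : ∀ i, IdentDistrib (as i) a μ μ)
    (φ₁ φ₂ : ℝ → ℝ) (L₁ L₂ : NNReal) (hφ₁ : LipschitzWith L₁ φ₁) (hφ₂ : LipschitzWith L₂ φ₂)
    (X Y : Set (EuclideanSpace ℝ (Fin d))) (D₁ D₂ : ℝ)
    (hX : X ⊆ Metric.closedBall 0 D₁) (hY : Y ⊆ Metric.closedBall 0 D₂)
    (B₁ B₂ : ℝ)
    (hB₁ : ∀ i, ∀ x ∈ X, ∀ᵐ ω ∂μ, |φ₁ (inner ℝ (as i ω) x)| ≤ B₁)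
    (hB₂ : ∀ i, ∀ y ∈ Y, ∀ᵐ ω ∂μ, |φ₂ (inner ℝ (as i ω) y)| ≤ B₂)
    (δ : ℝ) (hδ₀ : 0 < δ) (hδ₁ : δ ≤ 1) :
    1 - δ ≤ μ.real {ω | supDeviation μ a as φ₁ φ₂ X Y ω ≤
      ((√(4 * Real.pi) * (√(∫ ω', ‖a ω'‖ ^ 2 ∂μ) / √(n : ℝ)) * (B₂ * L₁ * D₁ + B₁ * L₂ * D₂)
        + 2 * B₁ * B₂ / √(2 * (n : ℝ)) * √(Real.log (1 / δ)) : ℝ) : EReal)} := by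
  set b := √(4 * Real.pi) * (√(∫ ω', ‖a ω'‖ ^ 2 ∂μ) / √(n : ℝ)) * (B₂ * L₁ * D₁ + B₁ * L₂ * D₂)
    + 2 * B₁ * B₂ / √(2 * (n : ℝ)) * √(Real.log (1 / δ)) with hb
  have hsup : ∀ ω, supDeviation μ a as φ₁ φ₂ X Y ω ≤ (b : EReal) ↔
      ∀ p : X ×ˢ Y, empiricalDeviation μ a as φ₁ φ₂ p.1.1 p.1.2 ω ≤ b := fun ω => by
    simp only [supDeviation, iSup_le_iff, EReal.coe_le_coe_iff]
    exact ⟨fun h p => h _ p.2.1 _ p.2.2, fun h x hx y hy => h ⟨(x, y), hx, hy⟩⟩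
  simp only [hsup]
  rcases isEmpty_or_nonempty (X ×ˢ Y : Set _) with hne | hne
  · simp [hδ₀.le]
  set u := TopologicalSpace.denseSeq (X ×ˢ Y : Set _)
  have ham : AEMeasurable a μ := ha.aestronglyMeasurable.aemeasurable
  have hcont := continuous_empiricalDeviation as ham hφ₁.continuous hφ₂.continuous
    (fun x hx => (hident ⟨0, hn⟩).ae_abs_comp_inner_le hφ₁.continuous (hB₁ _ x hx))
    (fun y hy => (hident ⟨0, hn⟩).ae_abs_comp_inner_le hφ₂.continuous (hB₂ _ y hy))
  set A : ℕ → Set Ω := fun k =>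
    {ω | ∀ j : Fin k, empiricalDeviation μ a as φ₁ φ₂ (u j).1.1 (u j).1.2 ω ≤ b} with hA
  have hset : {ω | ∀ p : X ×ˢ Y, empiricalDeviation μ a as φ₁ φ₂ p.1.1 p.1.2 ω ≤ b}
      = ⋂ k, A k := by
    ext ω
    simp only [hA, Set.mem_iInter, Set.mem_ofPred_eq]
    refine ⟨fun h k j => h _, fun h p => ?_⟩
    have hcl : IsClosed {p : X ×ˢ Y | empiricalDeviation μ a as φ₁ φ₂ p.1.1 p.1.2 ω ≤ b} :=
      isClosed_le (hcont ω) continuous_const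
    refine (TopologicalSpace.denseRange_denseSeq _).induction_on p hcl fun j => ?_
    -- `A k` tests the indices below `k`, so index `j` is first seen in `A (j + 1)`.
    exact h (j + 1) ⟨j, j.lt_succ_self⟩
  have hanti : Antitone A := fun k l hkl ω hω j => hω (Fin.castLE hkl j)
  have hmeas : ∀ k, NullMeasurableSet (A k) μ := fun k => by
    simp only [hA, Set.ofPred_forall]
    refine NullMeasurableSet.iInter fun j => nullMeasurableSet_le ?_ aemeasurable_const
    have h1 := hφ₁.continuous
    have h2 := hφ₂.continuous
    have hc : Continuous fun w : Fin n → EuclideanSpace ℝ (Fin d) => (1 / (n : ℝ))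
        * ∑ i, φ₁ (inner ℝ (w i) (u j).1.1) * φ₂ (inner ℝ (w i) (u j).1.2)
        - ∫ ω', φ₁ (inner ℝ (a ω') (u j).1.1) * φ₂ (inner ℝ (a ω') (u j).1.2) ∂μ := by fun_prop
    exact hc.measurable.comp_aemeasurable
      (aemeasurable_pi_lambda _ fun i => (hident i).aemeasurable_fst)
  -- Continuity from above: the finite bound `1 - δ` does not depend on `k`, so it survives in the
  -- limit.
  have hlim := tendsto_measure_iInter_atTop hmeas hanti ⟨0, measure_ne_top μ _⟩
  rw [hset]
  refine ge_of_tendsto' ((ENNReal.tendsto_toReal (measure_ne_top μ _)).comp hlim) fun k => ?_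
  exact empiricalDeviation_bound_of_finite hn ha hindep hident hφ₁ hφ₂
    (x := fun j : Fin k => (u j).1.1) (y := fun j : Fin k => (u j).1.2)
    (fun j => by simpa using hX (u j).2.1) (fun j => by simpa using hY (u j).2.2)
    (fun i j => hB₁ i _ (u j).2.1) (fun i j => hB₂ i _ (u j).2.2) hδ₀ hδ₁
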